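/- Let $E$ be a real Banach lattice with order continuous norm. Here the norm of a Banach lattice $G$ is called order continuous if $\|x_\alpha\|\to 0$ for every net $(x_\alpha)$ in $G$ that decreases with infimum $0$. A subset of $E$ is called L-weakly compact if it is norm bounded and every disjoint sequence in its solid hull converges to $0$ in norm. A continuous linear operator $T:E\to E$ is called almost L-weakly compact if $T(A)$ is L-weakly compact for every relatively weakly compact subset $A$ of $E$, and semi-compact if for every $\varepsilon>0$ there is $u\in E_+$ with $T(B_E)\subseteq[-u,u]+\varepsilon B_E$, where $B_E$ is the closed unit ball of $E$. Then the following assertions are equivalent: (1) every positive almost L-weakly compact operator $T:E\to E$ is semi-compact; (2) the norm of the dual Banach lattice $E'$ is order continuous. -/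

import Mathlib

open Set Filter Topology Pointwise

universe u

/-- The norm of an ordered normed space `V` is order continuous: for every net `x` in `V` with
`x ↓ 0` (decreasing, with infimum `0`) the norms `‖x i‖` tend to `0`. Nets indexed in the universe
of `V` suffice, as a decreasing net may be replaced by its range, a downward directed set. -/
def HasOrderContinuousNorm (V : Type u) [NormedAddCommGroup V] [PartialOrder V] : Prop :=
  ∀ (ι : Type u) [Preorder ι] [IsDirectedOrder ι] [Nonempty ι] (x : ι → V),
    Antitone x → IsGLB (range x) 0 → Tendsto (fun i => ‖x i‖) atTop (𝓝 0)

section BanachLattice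

variable (E : Type u) [NormedAddCommGroup E] [Lattice E] [HasSolidNorm E] [IsOrderedAddMonoid E]
  [NormedSpace ℝ E]

/-- The order of the dual Banach lattice `E'`: `f ≤ g` iff `f x ≤ g x` for all `x ≥ 0`. -/
@[reducible] def dualPartialOrder : PartialOrder (StrongDual ℝ E) where
  le f g := ∀ x : E, 0 ≤ x → f x ≤ g x
  le_refl _ _ _ := le_rfl
  le_trans _ _ _ hfg hgh x hx := (hfg x hx).trans (hgh x hx)
  le_antisymm f g hfg hgf := by
    ext x
    have h : ∀ y : E, 0 ≤ y → f y = g y := fun y hy => le_antisymm (hfg y hy) (hgf y hy)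
    rw [← posPart_sub_negPart x, map_sub, map_sub, h _ (posPart_nonneg x), h _ (negPart_nonneg x)]

/-- The dual `E'`, with the operator norm and the dual order, has order continuous norm. -/
def DualHasOrderContinuousNorm : Prop :=
  @HasOrderContinuousNorm (StrongDual ℝ E) _ (dualPartialOrder E)

variable {E}

/-- A disjoint sequence in a vector lattice. -/
def IsDisjointSeq (x : ℕ → E) : Prop :=
  ∀ m n, m ≠ n → |x m| ⊓ |x n| = 0

/-- A bounded set `A` is L-weakly compact if every disjoint sequence in its solid hull is norm
null. The solid hull is `{y | ∃ x ∈ A, |y| ≤ |x|}`. -/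
def IsLWeaklyCompact (A : Set E) : Prop :=
  Bornology.IsBounded A ∧
    ∀ x : ℕ → E, IsDisjointSeq x →
      (∀ n, x n ∈ LatticeOrderedAddCommGroup.solidClosure A) →
      Tendsto (fun n => ‖x n‖) atTop (𝓝 0)

/-- `A` is relatively weakly compact: its closure for the weak topology is weakly compact. -/
def IsRelWeaklyCompact {X : Type*} [NormedAddCommGroup X] [NormedSpace ℝ X] (A : Set X) : Prop :=
  IsCompact (closure (toWeakSpace ℝ X '' A))

/-- `T : X → E` is almost L-weakly compact: it carries relatively weakly compact subsets of `X`
onto L-weakly compact subsets of `E`. -/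
def IsAlmostLWeaklyCompact {X : Type*} [NormedAddCommGroup X] [NormedSpace ℝ X]
    (T : X →L[ℝ] E) : Prop :=
  ∀ A : Set X, IsRelWeaklyCompact A → IsLWeaklyCompact (T '' A)

/-- `T : X → E` is semi-compact: for each `ε > 0` there is `v ≥ 0` in `E` with
`T(B_X) ⊆ [-v, v] + ε B_E`, where the balls are the closed unit balls. -/
def IsSemiCompact {X : Type*} [NormedAddCommGroup X] [NormedSpace ℝ X]
    (T : X →L[ℝ] E) : Prop :=
  ∀ ε : ℝ, 0 < ε → ∃ v : E, 0 ≤ v ∧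
    T '' Metric.closedBall 0 1 ⊆ Icc (-v) v + ε • Metric.closedBall (0 : E) 1

/-- `T` is a positive operator. -/
def IsPositiveOperator {F : Type*} [NormedAddCommGroup F] [Lattice F] [NormedSpace ℝ F]
    (T : E →L[ℝ] F) : Prop :=
  ∀ x : E, 0 ≤ x → 0 ≤ T x

end BanachLattice

set_option linter.unusedSectionVars false

/-! ### Disjointness and positivity in normed lattices -/

section Lattice

variable {E : Type*} [NormedAddCommGroup E] [Lattice E] [HasSolidNorm E] [IsOrderedAddMonoid E]

/-! (2) ⇒ (1). When the norm of `E'` is order continuous, bounded disjoint positive sequences are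
weakly null (`DualHasOrderContinuousNorm.tendsto_of_disjoint`). Such a sequence has relatively
weakly compact range, so its image under `T` is L-weakly compact and weakly null, hence norm null
(`IsLWeaklyCompact.tendsto_norm`). Disjointification (`exists_norm_map_posPart_sub_le`) turns this
into a single `u` with `T (x - u)⁺` uniformly small on the positive part of the ball, and `T u`
serves as the order bound.

(1) ⇒ (2). It suffices that every positive `f` vanishes asymptotically along each disjoint positive
sequence `x n` in the ball (`dualHasOrderContinuousNorm_of_tendsto`). Restricting `f` to the bands
generated by the `x n` gives `φ n` with `φ n (x n) = f (x n)` and `φ m (x n) = 0` for `m ≠ n`. The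
operator `T y = ∑ φ n y • x n` factors through `ℓ¹`, so by the Schur property it maps relatively
weakly compact sets to almost order bounded ones, which are L-weakly compact because `E` has order
continuous norm. Thus `T` is semi-compact, the disjoint sequence `T (x n) = f (x n) • x n` is norm
null, and so is `f (x n) ^ 2`. -/

lemma norm_le_norm_of_nonneg_of_le {a b : E} (ha : 0 ≤ a) (hab : a ≤ b) : ‖a‖ ≤ ‖b‖ :=
  norm_le_norm_of_abs_le_abs (by rwa [abs_of_nonneg ha, abs_of_nonneg (ha.trans hab)])

lemma inf_add_posPart_sub (a b : E) : a ⊓ b + (a - b)⁺ = a := by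
  rw [inf_eq_sub_posPart_sub, sub_add_cancel]

lemma inf_add_le_of_nonneg {a b c : E} (ha : 0 ≤ a) (hb : 0 ≤ b) (hc : 0 ≤ c) :
    a ⊓ (b + c) ≤ a ⊓ b + a ⊓ c := by
  rw [add_inf, inf_add, inf_add]
  refine le_inf (le_inf ?_ ?_) (le_inf ?_ ?_)
  · exact inf_le_left.trans (le_add_of_nonneg_left ha)
  · exact inf_le_left.trans (le_add_of_nonneg_left hb)
  · exact inf_le_left.trans (le_add_of_nonneg_right hc)
  · exact inf_le_right

lemma inf_nsmul_eq_zero {a b : E} (ha : 0 ≤ a) (hb : 0 ≤ b) (h : a ⊓ b = 0) (n : ℕ) :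
    a ⊓ n • b = 0 := by
  induction n with
  | zero => simpa using ha
  | succ n ih =>
    refine le_antisymm ?_ (le_inf ha (nsmul_nonneg hb _))
    rw [succ_nsmul]
    simpa [ih, h] using inf_add_le_of_nonneg ha (nsmul_nonneg hb n) hb

lemma inf_sum_eq_zero {ι : Type*} {s : Finset ι} {a : E} {d : ι → E} (ha : 0 ≤ a)
    (hd : ∀ i ∈ s, 0 ≤ d i) (h : ∀ i ∈ s, a ⊓ d i = 0) : a ⊓ ∑ i ∈ s, d i = 0 := by
  classical
  induction s using Finset.induction_on with
  | empty => simpa using ha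
  | insert i s hi ih =>
    rw [Finset.sum_insert hi]
    have hs : 0 ≤ ∑ i ∈ s, d i := Finset.sum_nonneg fun j hj => hd j (by simp [hj])
    have hdi : 0 ≤ d i := hd i (by simp)
    refine le_antisymm ?_ (le_inf ha (add_nonneg hdi hs))
    have h1 := inf_add_le_of_nonneg ha hdi hs
    rwa [h i (by simp), ih (fun j hj => hd j (by simp [hj])) (fun j hj => h j (by simp [hj])),
      add_zero] at h1

/-- For disjoint elements `a + b = a ⊓ b + a ⊔ b` reduces to `a ⊔ b`, so the sum is a supremum. -/
lemma sum_le_of_disjoint {ι : Type*} {s : Finset ι} {v : E} {d : ι → E} (hv : 0 ≤ v)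
    (hd : ∀ i, 0 ≤ d i) (hdv : ∀ i, d i ≤ v) (h : ∀ i j, i ≠ j → d i ⊓ d j = 0) :
    ∑ i ∈ s, d i ≤ v := by
  classical
  induction s using Finset.induction_on with
  | empty => simpa using hv
  | insert i s hi ih =>
    rw [Finset.sum_insert hi, ← inf_add_sup, inf_sum_eq_zero (hd i) (fun j _ => hd j)
      (fun j hj => h i j (fun e => hi (e ▸ hj))), zero_add]
    exact sup_le (hdv i) ih

lemma IsDisjointSeq.abs_inf_mono {x y : ℕ → E} (hx : IsDisjointSeq x)
    (h : ∀ n, |y n| ≤ |x n|) : IsDisjointSeq y := fun m n hmn =>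
  le_antisymm ((inf_le_inf (h m) (h n)).trans (hx m n hmn).le) (le_inf (abs_nonneg _) (abs_nonneg _))

lemma IsDisjointSeq.inf_eq_zero {x : ℕ → E} (hx : IsDisjointSeq x) (h0 : ∀ n, 0 ≤ x n) {m n : ℕ}
    (hmn : m ≠ n) : x m ⊓ x n = 0 := by
  simpa only [abs_of_nonneg (h0 _)] using hx m n hmn

variable [NormedSpace ℝ E] [IsOrderedModule ℝ E]

lemma nonpos_of_forall_nsmul_le {w a : E} (h : ∀ k : ℕ, k • w ≤ a) : w ≤ 0 := by
  have h1 : ∀ k : ℕ, w ≤ ((k : ℝ) + 1)⁻¹ • a := fun k => by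
    have h2 := smul_le_smul_of_nonneg_left (h (k + 1)) (a := ((k : ℝ) + 1)⁻¹) (by positivity)
    rwa [← Nat.cast_smul_eq_nsmul ℝ, smul_smul, Nat.cast_add, Nat.cast_one,
      inv_mul_cancel₀ (by positivity), one_smul] at h2
  have h3 : Tendsto (fun k : ℕ => ((k : ℝ) + 1)⁻¹ • a) atTop (𝓝 ((0 : ℝ) • a)) := by
    refine Tendsto.smul_const ?_ a
    simpa [one_div] using tendsto_one_div_add_atTop_nhds_zero_nat (𝕜 := ℝ)
  rw [zero_smul] at h3
  exact ge_of_tendsto' h3 h1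

lemma inf_smul_eq_zero {a b : E} (ha : 0 ≤ a) (hb : 0 ≤ b) (h : a ⊓ b = 0) {c : ℝ} (hc : 0 ≤ c) :
    a ⊓ c • b = 0 := by
  obtain ⟨n, hn⟩ := exists_nat_ge c
  refine le_antisymm ?_ (le_inf ha (smul_nonneg hc hb))
  rw [← inf_nsmul_eq_zero ha hb h n, ← Nat.cast_smul_eq_nsmul ℝ]
  exact inf_le_inf_left _ (smul_le_smul_of_nonneg_right hn hb)

lemma posPart_smul_of_nonneg {c : ℝ} (hc : 0 < c) (a : E) : (c • a)⁺ = c • a⁺ := by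
  refine le_antisymm (sup_le (smul_le_smul_of_nonneg_left (le_posPart a) hc.le)
    (smul_nonneg hc.le (posPart_nonneg a))) ?_
  rw [← le_inv_smul_iff_of_pos hc]
  refine sup_le ?_ (smul_nonneg (by positivity) (posPart_nonneg _))
  rw [le_inv_smul_iff_of_pos hc]
  exact le_posPart _

lemma le_tsum_smul_pow {x : ℕ → E} {C : ℝ} [CompleteSpace E] (h0 : ∀ n, 0 ≤ x n)
    (hC : ∀ n, ‖x n‖ ≤ C) (n : ℕ) : (1 / 2 : ℝ) ^ n • x n ≤ ∑' i, (1 / 2 : ℝ) ^ i • x i := by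
  have hs : Summable (fun i => (1 / 2 : ℝ) ^ i • x i) := by
    refine Summable.of_norm_bounded (g := fun i => (1 / 2 : ℝ) ^ i * C)
      (summable_geometric_two.mul_right C) fun i => ?_
    rw [norm_smul, norm_pow, Real.norm_of_nonneg (by norm_num)]
    exact mul_le_mul_of_nonneg_left (hC i) (by positivity)
  exact hs.le_tsum n fun j _ => smul_nonneg (by positivity) (h0 j)

lemma map_mono_of_nonneg {F : Type*} [NormedAddCommGroup F] [Lattice F]
    [IsOrderedAddMonoid F] [NormedSpace ℝ F] {T : E →L[ℝ] F} (hT : IsPositiveOperator T)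
    {x y : E} (h : x ≤ y) : T x ≤ T y := by
  have := hT (y - x) (sub_nonneg.2 h)
  rwa [map_sub, sub_nonneg] at this

lemma abs_map_le {F : Type*} [NormedAddCommGroup F] [Lattice F]
    [IsOrderedAddMonoid F] [NormedSpace ℝ F] {T : E →L[ℝ] F} (hT : IsPositiveOperator T) (x : E) :
    |T x| ≤ T |x| := by
  refine abs_le'.2 ⟨map_mono_of_nonneg hT (le_abs_self x), ?_⟩
  rw [← map_neg]
  exact map_mono_of_nonneg hT (neg_le_abs x)

end Lattice

/-! ### Positive functionals -/

section Dual

variable {E : Type*} [NormedAddCommGroup E] [Lattice E] [HasSolidNorm E] [IsOrderedAddMonoid E]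
  [NormedSpace ℝ E] [IsOrderedModule ℝ E]

lemma norm_posPart_le (x : E) : ‖x⁺‖ ≤ ‖x‖ :=
  norm_le_norm_of_abs_le_abs (by
    rw [abs_of_nonneg (posPart_nonneg x)]; exact sup_le (le_abs_self x) (abs_nonneg x))

lemma norm_negPart_le (x : E) : ‖x⁻‖ ≤ ‖x‖ := by
  simpa using norm_posPart_le (-x)

/-- An additive function on the positive cone, bounded by a multiple of the norm, extends to a
continuous linear functional. -/
lemma exists_strongDual_of_additive_on_nonneg (p : E → ℝ) (C : ℝ)
    (hadd : ∀ x y, 0 ≤ x → 0 ≤ y → p (x + y) = p x + p y)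
    (hC : ∀ x, 0 ≤ x → |p x| ≤ C * ‖x‖) :
    ∃ g : StrongDual ℝ E, ∀ x, 0 ≤ x → g x = p x := by
  have h0 : p 0 = 0 := by simpa using hadd 0 0 le_rfl le_rfl
  let F : E →+ ℝ :=
    { toFun := fun x => p x⁺ - p x⁻
      map_zero' := by simp
      map_add' := fun x y => by
        have h1 : (x + y)⁺ + (x⁻ + y⁻) = (x + y)⁻ + (x⁺ + y⁺) := by
          rw [← sub_eq_zero]
          have e : (x + y)⁺ + (x⁻ + y⁻) - ((x + y)⁻ + (x⁺ + y⁺)) =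
            ((x + y)⁺ - (x + y)⁻) - ((x⁺ - x⁻) + (y⁺ - y⁻)) := by abel
          rw [e, posPart_sub_negPart, posPart_sub_negPart, posPart_sub_negPart, sub_self]
        have h2 := congrArg p h1
        have hx := posPart_nonneg x
        have hy := posPart_nonneg y
        have hx' := negPart_nonneg x
        have hy' := negPart_nonneg y
        rw [hadd _ _ (posPart_nonneg _) (add_nonneg hx' hy'), hadd _ _ hx' hy',
          hadd _ _ (negPart_nonneg _) (add_nonneg hx hy), hadd _ _ hx hy] at h2
        linarith }
  have hF : Continuous F := by
    refine AddMonoidHomClass.continuous_of_bound F (2 * |C|) fun x => ?_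
    have hp : ∀ y : E, 0 ≤ y → ‖y‖ ≤ ‖x‖ → |p y| ≤ |C| * ‖x‖ := fun y hy hyx =>
      (hC y hy).trans (mul_le_mul (le_abs_self C) hyx (norm_nonneg _) (abs_nonneg _))
    have h1 := hp _ (posPart_nonneg x) (norm_posPart_le x)
    have h2 := hp _ (negPart_nonneg x) (norm_negPart_le x)
    calc ‖F x‖ = |p x⁺ - p x⁻| := rfl
      _ ≤ |p x⁺| + |p x⁻| := abs_sub _ _
      _ ≤ 2 * |C| * ‖x‖ := by linarith
  refine ⟨F.toRealLinearMap hF, fun x hx => ?_⟩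
  change p x⁺ - p x⁻ = p x
  rw [posPart_of_nonneg hx, negPart_of_nonneg hx, h0, sub_zero]

/-- The positive part of a functional: every functional is dominated on the positive cone by a
positive functional of no greater norm. -/
lemma exists_nonneg_ge (f : StrongDual ℝ E) :
    ∃ g : StrongDual ℝ E, IsPositiveOperator g ∧ (∀ x, 0 ≤ x → f x ≤ g x) ∧
      ∀ x, 0 ≤ x → g x ≤ ‖f‖ * ‖x‖ := by
  -- The Riesz–Kantorovich formula for the positive part of `f`.
  let p : E → ℝ := fun x => sSup (f '' Icc 0 x)
  have hb : ∀ x, ∀ r ∈ f '' Icc 0 x, r ≤ ‖f‖ * ‖x‖ := by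
    rintro x _ ⟨y, hy, rfl⟩
    exact (le_abs_self _).trans ((f.le_opNorm y).trans (mul_le_mul_of_nonneg_left
      (norm_le_norm_of_nonneg_of_le hy.1 hy.2) (norm_nonneg _)))
  have hbdd : ∀ x, BddAbove (f '' Icc 0 x) := fun x => ⟨_, hb x⟩
  have hp : ∀ x y, y ∈ Icc 0 x → f y ≤ p x := fun x y hy => le_csSup (hbdd x) ⟨y, hy, rfl⟩
  have hp0 : ∀ x, 0 ≤ x → 0 ≤ p x := fun x hx => by
    simpa using hp x 0 ⟨le_rfl, hx⟩
  have hpC : ∀ x, 0 ≤ x → p x ≤ ‖f‖ * ‖x‖ := fun x hx =>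
    csSup_le ⟨f 0, 0, ⟨le_rfl, hx⟩, rfl⟩ (hb x)
  obtain ⟨g, hg⟩ := exists_strongDual_of_additive_on_nonneg p ‖f‖ (fun x y hx hy => by
    refine le_antisymm ?_ ?_
    · refine csSup_le ⟨f 0, 0, ⟨le_rfl, add_nonneg hx hy⟩, rfl⟩ ?_
      rintro _ ⟨z, hz, rfl⟩
      -- Riesz decomposition: `z ≤ x + y` splits as `z ⊓ x ≤ x` plus `(z - x)⁺ ≤ y`.
      have h1 := hp x (z ⊓ x) ⟨le_inf hz.1 hx, inf_le_right⟩
      have h2 := hp y (z - x)⁺ ⟨posPart_nonneg _, sup_le (sub_le_iff_le_add'.2 hz.2) hy⟩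
      rw [← inf_add_posPart_sub z x, map_add]
      linarith
    · have h1 : p x ≤ p (x + y) - p y := by
        refine csSup_le ⟨f 0, 0, ⟨le_rfl, hx⟩, rfl⟩ ?_
        rintro _ ⟨a, ha, rfl⟩
        rw [le_sub_comm]
        refine csSup_le ⟨f 0, 0, ⟨le_rfl, hy⟩, rfl⟩ ?_
        rintro _ ⟨b, hb', rfl⟩
        have := hp (x + y) (a + b) ⟨add_nonneg ha.1 hb'.1, add_le_add ha.2 hb'.2⟩
        rw [map_add] at this
        linarith
      linarith) (fun x hx => by rw [abs_of_nonneg (hp0 x hx)]; exact hpC x hx)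
  refine ⟨g, fun x hx => ?_, fun x hx => ?_, fun x hx => ?_⟩ <;> rw [hg x hx]
  · exact hp0 x hx
  · exact hp x x ⟨hx, le_rfl⟩
  · exact hpC x hx

lemma norm_le_of_forall_nonneg {g : StrongDual ℝ E} (hg : IsPositiveOperator g) {C : ℝ} (hC : 0 ≤ C)
    (h : ∀ x, 0 ≤ x → ‖x‖ ≤ 1 → g x ≤ C) : ‖g‖ ≤ C := by
  refine g.opNorm_le_of_unit_norm hC fun x hx => ?_
  exact (abs_map_le hg x).trans (h _ (abs_nonneg x) (by rw [norm_abs_eq_norm, hx]))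

lemma exists_nonneg_norming (z : E) : ∃ g : StrongDual ℝ E, IsPositiveOperator g ∧ ‖g‖ ≤ 1 ∧
    (0 ≤ z → ‖z‖ ≤ g z) := by
  obtain ⟨f, hf1, hfz⟩ := exists_dual_vector'' ℝ z
  obtain ⟨g, hg, hfg, hgf⟩ := exists_nonneg_ge f
  refine ⟨g, hg, norm_le_of_forall_nonneg hg zero_le_one fun x hx hx1 => ?_, fun hz => ?_⟩
  · exact (hgf x hx).trans (mul_le_one₀ hf1 (norm_nonneg _) hx1)
  · simpa [hfz] using hfg z hz

/-- With `g` from `exists_nonneg_ge`, `f = g - (g - f)` is a difference of positive functionals. -/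
lemma tendsto_zero_of_forall_nonneg {ι : Type*} {l : Filter ι} {x : ι → E}
    (h : ∀ f : StrongDual ℝ E, IsPositiveOperator f → Tendsto (fun i => f (x i)) l (𝓝 0))
    (f : StrongDual ℝ E) : Tendsto (fun i => f (x i)) l (𝓝 0) := by
  obtain ⟨g, hg, hfg, -⟩ := exists_nonneg_ge f
  have h1 := (h g hg).sub (h (g - f) fun x hx => by simpa using hfg x hx)
  simpa using h1

end Dual

/-! ### Consequences of an order continuous norm -/

section OrderContinuous

variable {E : Type u} [NormedAddCommGroup E] [Lattice E] [HasSolidNorm E] [IsOrderedAddMonoid E]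
  [NormedSpace ℝ E] [IsOrderedModule ℝ E]

/-- The differences `w - s n`, over upper bounds `w` of `s` and `n : ℕ`, form a net decreasing to
`0`: subtracting a lower bound of the net from an upper bound of `s` leaves an upper bound, and this
can be iterated, so the Archimedean property makes the lower bound nonpositive. -/
lemma HasOrderContinuousNorm.cauchySeq_of_monotone (hE : HasOrderContinuousNorm E) {s : ℕ → E}
    (hs : Monotone s) {v : E} (hv : ∀ n, s n ≤ v) : CauchySeq s := by
  let U := {w : E // ∀ n, s n ≤ w}
  have : IsDirectedOrder Uᵒᵈ := ⟨fun a b =>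
    ⟨OrderDual.toDual ⟨(OrderDual.ofDual a).1 ⊓ (OrderDual.ofDual b).1,
      fun n => le_inf ((OrderDual.ofDual a).2 n) ((OrderDual.ofDual b).2 n)⟩,
      inf_le_left, inf_le_right⟩⟩
  have : Nonempty Uᵒᵈ := ⟨OrderDual.toDual ⟨v, hv⟩⟩
  have : IsDirectedOrder (Uᵒᵈ × ULift.{u} ℕ) := ⟨fun a b => by
    obtain ⟨c, hc1, hc2⟩ := exists_ge_ge a.1 b.1
    exact ⟨(c, ⟨max a.2.down b.2.down⟩), ⟨hc1, le_max_left a.2.down b.2.down⟩,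
      ⟨hc2, le_max_right a.2.down b.2.down⟩⟩⟩
  have h1 := hE (Uᵒᵈ × ULift.{u} ℕ) (fun p => (OrderDual.ofDual p.1).1 - s p.2.down)
    (fun p q hpq => sub_le_sub hpq.1 (hs hpq.2)) (by
      constructor
      · rintro _ ⟨p, rfl⟩
        exact sub_nonneg.2 ((OrderDual.ofDual p.1).2 _)
      · intro w hw
        have hw' : ∀ a : U, ∀ n, w ≤ a.1 - s n := fun a n => hw ⟨(OrderDual.toDual a, ⟨n⟩), rfl⟩
        have hk : ∀ k : ℕ, ∀ n, s n ≤ v - k • w := fun k => by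
          induction k with
          | zero => simpa using hv
          | succ k ih =>
            intro n
            have := hw' ⟨_, ih⟩ n
            rw [succ_nsmul, ← sub_sub]
            exact le_sub_comm.1 this
        exact nonpos_of_forall_nsmul_le (a := v - s 0) fun k => le_sub_comm.1 (hk k 0))
  rw [Metric.cauchySeq_iff']
  intro ε hε
  obtain ⟨p, hp⟩ := (h1.eventually (gt_mem_nhds hε)).exists
  refine ⟨p.2.down, fun n hn => ?_⟩
  rw [dist_eq_norm]
  refine lt_of_le_of_lt (norm_le_norm_of_nonneg_of_le (sub_nonneg.2 (hs hn)) ?_) hp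
  exact sub_le_sub_right ((OrderDual.ofDual p.1).2 n) _

lemma HasOrderContinuousNorm.tendsto_norm_of_disjoint (hE : HasOrderContinuousNorm E) {d : ℕ → E}
    (hd : ∀ n, 0 ≤ d n) (hdis : IsDisjointSeq d) {v : E} (hv : ∀ n, d n ≤ v) :
    Tendsto (fun n => ‖d n‖) atTop (𝓝 0) := by
  have hc := hE.cauchySeq_of_monotone (s := fun n => ∑ i ∈ Finset.range n, d i) (v := v)
    (fun m n hmn => Finset.sum_le_sum_of_subset_of_nonneg (Finset.range_mono hmn)
      fun i _ _ => hd i)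
    (fun n => sum_le_of_disjoint ((hd 0).trans (hv 0)) hd hv fun i j => hdis.inf_eq_zero hd)
  rw [Metric.cauchySeq_iff] at hc
  rw [Metric.tendsto_atTop]
  intro ε hε
  obtain ⟨N, hN⟩ := hc ε hε
  refine ⟨N, fun n hn => ?_⟩
  have := hN (n + 1) (by lia) n hn
  simpa [Finset.sum_range_succ, dist_eq_norm] using this

/-- A weighted sum `φ` of norming functionals of the `z n` controls them all. Along a subsequence
with `φ (y k) ≤ 2⁻ᵏ`, the tail suprema `s N` decrease to a limit killed by `φ`, hence by every
norming functional; so `‖y N‖` is at most the distance from `s N` to its limit. -/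
lemma HasOrderContinuousNorm.tendsto_norm_of_orderBounded [CompleteSpace E]
    (hE : HasOrderContinuousNorm E) {z : ℕ → E} {u : E} (hz : ∀ n, 0 ≤ z n) (hu : ∀ n, z n ≤ u)
    (hw : ∀ f : StrongDual ℝ E, IsPositiveOperator f → Tendsto (fun n => f (z n)) atTop (𝓝 0)) :
    Tendsto (fun n => ‖z n‖) atTop (𝓝 0) := by
  choose f hf hf1 hfz using fun n => exists_nonneg_norming (z n)
  have hsum : Summable (fun n => (1 / 2 : ℝ) ^ n • f n) := by
    refine Summable.of_norm_bounded (g := fun i => (1 / 2 : ℝ) ^ i)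
      summable_geometric_two fun i => ?_
    rw [norm_smul, norm_pow, Real.norm_of_nonneg (by norm_num)]
    exact mul_le_of_le_one_right (by positivity) (hf1 i)
  obtain ⟨φ, hφ⟩ := hsum
  have hφx : ∀ x, HasSum (fun n => (1 / 2 : ℝ) ^ n * f n x) (φ x) := fun x => by
    simpa using! (ContinuousLinearMap.apply ℝ ℝ x).hasSum hφ
  have hφpos : IsPositiveOperator φ := fun x hx =>
    (hφx x).nonneg fun n => mul_nonneg (by positivity) (hf n x hx)
  have hφf : ∀ x, 0 ≤ x → φ x ≤ 0 → ∀ n, f n x = 0 := fun x hx h n => by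
    have h1 := le_hasSum (hφx x) n fun j _ => mul_nonneg (by positivity) (hf j x hx)
    have h2 : 0 < (1 / 2 : ℝ) ^ n := by positivity
    have h3 := hf n x hx
    nlinarith
  refine tendsto_of_subseq_tendsto fun ns hns => ?_
  have h1 : ∀ k : ℕ, ∃ m, φ (z (ns m)) ≤ (1 / 2 : ℝ) ^ k ∧ k ≤ m := fun k => by
    have := ((hw φ hφpos).comp hns).eventually_le_const
      (show (0 : ℝ) < (1 / 2 : ℝ) ^ k by positivity)
    exact (this.and (eventually_ge_atTop k)).exists
  choose ms hms hmk using h1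
  refine ⟨ms, ?_⟩
  set y : ℕ → E := fun k => z (ns (ms k)) with hy
  have hsupC : ∀ N, ∃ l, Tendsto (fun M => partialSups (fun k => y (N + k)) M) atTop (𝓝 l) :=
    fun N => cauchySeq_tendsto_of_complete (hE.cauchySeq_of_monotone (partialSups_monotone _)
      (v := u) fun n => partialSups_le _ _ _ fun _ _ => hu _)
  choose s hs using hsupC
  have hys : ∀ N k, y (N + k) ≤ s N := fun N k => by
    refine ge_of_tendsto (hs N) ?_
    filter_upwards [eventually_ge_atTop k] with M hM
    exact le_partialSups_of_le (fun k => y (N + k)) hM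
  have hs_le : ∀ N w, (∀ k, y (N + k) ≤ w) → s N ≤ w := fun N w h =>
    le_of_tendsto' (hs N) fun M => partialSups_le _ _ _ fun k _ => h k
  have hanti : Antitone s := antitone_nat_of_succ_le fun N => hs_le _ _ fun k => by
    have := hys N (k + 1)
    rwa [show N + (k + 1) = N + 1 + k by ring] at this
  have hs0 : ∀ N, 0 ≤ s N := fun N => (hz _).trans (hys N 0)
  have hsφ : ∀ N, φ (s N) ≤ 2 * (1 / 2 : ℝ) ^ N := fun N => by
    refine le_of_tendsto' ((φ.continuous.tendsto _).comp (hs N)) fun M => ?_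
    have h2 : partialSups (fun k => y (N + k)) M ≤ ∑ k ∈ Finset.range (M + 1), y (N + k) :=
      partialSups_le _ _ _ fun k hk => Finset.single_le_sum (f := fun k => y (N + k))
        (fun _ _ => hz _) (Finset.mem_range.2 (by lia))
    calc φ (partialSups (fun k => y (N + k)) M) ≤ φ (∑ k ∈ Finset.range (M + 1), y (N + k)) :=
          map_mono_of_nonneg hφpos h2
      _ = ∑ k ∈ Finset.range (M + 1), φ (y (N + k)) := map_sum _ _ _
      _ ≤ ∑ k ∈ Finset.range (M + 1), (1 / 2 : ℝ) ^ N * (1 / 2 : ℝ) ^ k :=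
          Finset.sum_le_sum fun k _ => by rw [← pow_add]; exact hms _
      _ = (1 / 2 : ℝ) ^ N * ∑ k ∈ Finset.range (M + 1), (1 / 2 : ℝ) ^ k := by
          rw [Finset.mul_sum]
      _ ≤ (1 / 2 : ℝ) ^ N * 2 := by
          refine mul_le_mul_of_nonneg_left ?_ (by positivity)
          exact sum_geometric_two_le _
      _ = _ := mul_comm _ _
  obtain ⟨t, ht⟩ : ∃ t, Tendsto (fun N => u - s N) atTop (𝓝 t) :=
    cauchySeq_tendsto_of_complete (hE.cauchySeq_of_monotone
      (fun a b hab => sub_le_sub_left (hanti hab) u) (v := u) fun n => sub_le_self _ (hs0 n))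
  have ht' : Tendsto s atTop (𝓝 (u - t)) := by simpa using ht.const_sub u
  have hφt : φ (u - t) ≤ 0 := by
    refine le_of_tendsto_of_tendsto' ((φ.continuous.tendsto _).comp ht') ?_ hsφ
    simpa using (tendsto_pow_atTop_nhds_zero_of_lt_one (r := (1 / 2 : ℝ)) (by norm_num)
      (by norm_num)).const_mul 2
  have hft := hφf _ (ge_of_tendsto' ht' hs0) hφt
  have hlim : Tendsto (fun N => ‖s N - (u - t)‖) atTop (𝓝 0) :=
    tendsto_iff_norm_sub_tendsto_zero.1 ht'
  refine squeeze_zero (fun _ => norm_nonneg _) (fun N => ?_) hlim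
  have h4 : ‖y N‖ ≤ f (ns (ms N)) (s N - (u - t)) := by
    rw [map_sub, hft, sub_zero]
    exact (hfz _ (hz _)).trans (map_mono_of_nonneg (hf _) (hys N 0))
  refine h4.trans ((le_abs_self _).trans ((f (ns (ms N))).le_of_opNorm_le (hf1 _) _ |>.trans ?_))
  rw [one_mul]

end OrderContinuous

/-! ### Disjointification -/

section Disjointification

variable {E : Type*} [NormedAddCommGroup E] [Lattice E] [HasSolidNorm E] [IsOrderedAddMonoid E]
  [NormedSpace ℝ E] [IsOrderedModule ℝ E] [CompleteSpace E]
  {F : Type*} [NormedAddCommGroup F] [Lattice F] [HasSolidNorm F] [IsOrderedAddMonoid F]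
  [NormedSpace ℝ F]

/-- The second factor is at most `c⁻¹ • (a - c • b)⁻`, which is disjoint from `(a - c • b)⁺`. -/
lemma inf_posPart_sub_smul_eq_zero {a b : E} {c d : ℝ} (hc : 0 < c) (hd : c⁻¹ ≤ d) (ha : 0 ≤ a) :
    (a - c • b)⁺ ⊓ (b - d • a)⁺ = 0 := by
  refine le_antisymm ?_ (le_inf (posPart_nonneg _) (posPart_nonneg _))
  have h1 : (b - d • a)⁺ ≤ c⁻¹ • (a - c • b)⁻ := by
    rw [← posPart_neg, ← posPart_smul_of_nonneg (inv_pos.2 hc)]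
    refine posPart_mono ?_
    rw [neg_sub, smul_sub, smul_smul, inv_mul_cancel₀ hc.ne', one_smul]
    exact sub_le_sub_left (smul_le_smul_of_nonneg_right hd ha) b
  refine (inf_le_inf_left _ h1).trans (inf_smul_eq_zero (posPart_nonneg _) (negPart_nonneg _)
    (posPart_inf_negPart_eq_zero _) (by positivity)).le

/-- If a positive operator is norm null along the disjoint positive sequences dominated by elements
of a bounded set `A` of positive elements, then it is small on `(x - u)⁺`, uniformly in `x ∈ A`,
for some `u ≥ 0`. -/
lemma exists_norm_map_posPart_sub_le {T : E →L[ℝ] F} (hT : IsPositiveOperator T) {A : Set E} {C : ℝ}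
    (hA : ∀ x ∈ A, 0 ≤ x) (hAC : ∀ x ∈ A, ‖x‖ ≤ C)
    (hd : ∀ v : ℕ → E, (∀ n, 0 ≤ v n) → IsDisjointSeq v → (∀ n, ∃ x ∈ A, v n ≤ x) →
      Tendsto (fun n => ‖T (v n)‖) atTop (𝓝 0)) {ε : ℝ} (hε : 0 < ε) :
    ∃ u, 0 ≤ u ∧ ∀ x ∈ A, ‖T (x - u)⁺‖ ≤ ε := by
  by_contra! hcon
  choose! χ hχA hχ using hcon
  -- `x n` is a counterexample to the bound `u = 4ⁿ • S n`, where `S n` is the sum of the earlier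
  -- terms.
  let S : ℕ → E := fun n => Nat.rec 0 (fun n s => s + χ ((4 : ℝ) ^ n • s)) n
  let x : ℕ → E := fun n => χ ((4 : ℝ) ^ n • S n)
  have hS : ∀ n, S (n + 1) = S n + x n := fun n => rfl
  have hS0 : ∀ n, 0 ≤ S n := fun n => by
    induction n with
    | zero => exact le_rfl
    | succ n ih => exact add_nonneg ih (hA _ (hχA _ (smul_nonneg (by positivity) ih)))
  have h4S : ∀ n, 0 ≤ (4 : ℝ) ^ n • S n := fun n => smul_nonneg (by positivity) (hS0 n)
  have hxA : ∀ n, x n ∈ A := fun n => hχA _ (h4S n)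
  have hx0 : ∀ n, 0 ≤ x n := fun n => hA _ (hxA n)
  have hSmono : Monotone S := monotone_nat_of_le_succ fun n => by
    rw [hS]; exact le_add_of_nonneg_right (hx0 n)
  have hxS : ∀ n m, n < m → x n ≤ S m := fun n m hnm =>
    (by rw [hS]; exact le_add_of_nonneg_left (hS0 n) : x n ≤ S (n + 1)).trans (hSmono hnm)
  have hw := le_tsum_smul_pow hx0 fun n => hAC _ (hxA n)
  set w := ∑' i, (1 / 2 : ℝ) ^ i • x i
  have hw0 : 0 ≤ w := (by simpa using hx0 0 : 0 ≤ (1 / 2 : ℝ) ^ 0 • x 0).trans (hw 0)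
  have hw0' : ∀ n : ℕ, 0 ≤ (1 / 2 : ℝ) ^ n • w := fun n => smul_nonneg (by positivity) hw0
  -- For `n < m`, `4ᵐ • S m` dominates `4ᵐ • x n`, and `2⁻ⁿ • w` dominates `2⁻⁽ⁿ⁺ᵐ⁾ • x m`. Since
  -- `2ⁿ⁺ᵐ ≤ 4ᵐ`, the preceding lemma makes the `v n` disjoint; the correction `2⁻ⁿ • w` is
  -- negligible in the limit.
  let v : ℕ → E := fun n => (x n - (4 : ℝ) ^ n • S n - (1 / 2 : ℝ) ^ n • w)⁺
  have hv0 : ∀ n, 0 ≤ v n := fun n => posPart_nonneg _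
  have hdis : ∀ n m, n < m → v n ⊓ v m = 0 := fun n m hnm => by
    refine le_antisymm ?_ (le_inf (hv0 n) (hv0 m))
    have hc : (0 : ℝ) < (1 / 2 : ℝ) ^ (n + m) := by positivity
    rw [← inf_posPart_sub_smul_eq_zero (a := x n) (b := x m) (d := (4 : ℝ) ^ m) hc ?_ (hx0 n)]
    · refine inf_le_inf (posPart_mono ?_) (posPart_mono ?_)
      · rw [sub_sub]
        refine sub_le_sub_left ?_ _
        rw [pow_add, mul_smul]
        exact (smul_le_smul_of_nonneg_left (hw m) (by positivity)).trans
          (le_add_of_nonneg_left (h4S n))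
      · rw [sub_sub]
        refine sub_le_sub_left ?_ _
        exact (smul_le_smul_of_nonneg_left (hxS n m hnm) (by positivity)).trans
          (le_add_of_nonneg_right (hw0' m))
    · rw [one_div, inv_pow, inv_inv, show (4 : ℝ) = 2 ^ 2 by norm_num, ← pow_mul]
      exact pow_le_pow_right₀ (by norm_num) (by lia)
  have hvdis : IsDisjointSeq v := fun m n hmn => by
    rw [abs_of_nonneg (hv0 _), abs_of_nonneg (hv0 _)]
    rcases lt_or_gt_of_ne hmn with h | h
    · exact hdis m n h
    · rw [inf_comm]; exact hdis n m h
  have hlim := hd v hv0 hvdis fun n => ⟨x n, hxA n, sup_le (by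
    rw [sub_sub]; exact sub_le_self _ (add_nonneg (h4S n) (hw0' n))) (hx0 n)⟩
  have hlim2 : Tendsto (fun n : ℕ => ‖T (v n)‖ + (1 / 2 : ℝ) ^ n * ‖T w‖) atTop (𝓝 0) := by
    simpa using hlim.add ((tendsto_pow_atTop_nhds_zero_of_lt_one (r := (1 / 2 : ℝ)) (by norm_num)
      (by norm_num)).mul_const ‖T w‖)
  refine hε.not_ge (ge_of_tendsto' hlim2 fun n => ?_)
  refine (hχ _ (h4S n)).le.trans ?_
  have h1 : (x n - (4 : ℝ) ^ n • S n)⁺ ≤ v n + (1 / 2 : ℝ) ^ n • w :=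
    sup_le (sub_le_iff_le_add.1 (le_posPart _)) (add_nonneg (hv0 n) (hw0' n))
  refine (norm_le_norm_of_nonneg_of_le (hT _ (posPart_nonneg _)) (map_mono_of_nonneg hT h1)).trans ?_
  rw [map_add, map_smul]
  refine (norm_add_le _ _).trans ?_
  rw [norm_smul, norm_pow, Real.norm_of_nonneg (by norm_num : (0:ℝ) ≤ 1 / 2)]

end Disjointification

/-! ### Restricting functionals to bands -/

section Bands

variable {E : Type*} [NormedAddCommGroup E] [Lattice E] [HasSolidNorm E] [IsOrderedAddMonoid E]
  [NormedSpace ℝ E] [IsOrderedModule ℝ E]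

/-- A pointwise limit, on the positive cone, of positive functionals dominated by `f`. -/
lemma exists_strongDual_of_tendsto {ι : Type*} {l : Filter ι} [l.NeBot] {q : ι → E → ℝ} {p : E → ℝ}
    {f : StrongDual ℝ E}
    (hadd : ∀ x y, 0 ≤ x → 0 ≤ y → p (x + y) = p x + p y)
    (hq0 : ∀ᶠ i in l, ∀ x, 0 ≤ x → 0 ≤ q i x) (hqf : ∀ᶠ i in l, ∀ x, 0 ≤ x → q i x ≤ f x)
    (hlim : ∀ x, 0 ≤ x → Tendsto (fun i => q i x) l (𝓝 (p x))) :
    ∃ g : StrongDual ℝ E, ∀ x, 0 ≤ x → g x = p x := by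
  refine exists_strongDual_of_additive_on_nonneg p ‖f‖ hadd fun x hx => ?_
  have h0 : 0 ≤ p x := ge_of_tendsto (hlim x hx) (hq0.mono fun i hi => hi x hx)
  have h1 : p x ≤ f x := le_of_tendsto (hlim x hx) (hqf.mono fun i hi => hi x hx)
  rw [abs_of_nonneg h0]
  exact h1.trans ((le_abs_self _).trans (f.le_opNorm x))

/-- The restriction of a positive functional `f` to the band generated by `u ≥ 0`. -/
lemma exists_band_restriction {f : StrongDual ℝ E} (hf : IsPositiveOperator f) {u : E}
    (hu : 0 ≤ u) : ∃ g : StrongDual ℝ E, ∀ x, 0 ≤ x →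
      Tendsto (fun k : ℕ => f (x ⊓ k • u)) atTop (𝓝 (g x)) := by
  have hmono : ∀ x, Monotone (fun k : ℕ => f (x ⊓ k • u)) := fun x a b hab =>
    map_mono_of_nonneg hf (inf_le_inf_left _ (nsmul_le_nsmul_left hu hab))
  have hlim : ∀ x, Tendsto (fun k : ℕ => f (x ⊓ k • u)) atTop (𝓝 (⨆ k : ℕ, f (x ⊓ k • u))) :=
    fun x => tendsto_atTop_ciSup (hmono x)
      ⟨f x, by rintro _ ⟨k, rfl⟩; exact map_mono_of_nonneg hf inf_le_left⟩
  obtain ⟨g, hg⟩ := exists_strongDual_of_tendsto (l := atTop) (f := f)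
    (q := fun k x => f (x ⊓ k • u)) (fun x y hx hy => by
      refine le_antisymm (le_of_tendsto_of_tendsto' (hlim _) ((hlim x).add (hlim y)) fun k => ?_)
        (le_of_tendsto_of_tendsto' ((hlim x).add (hlim y))
          ((hlim (x + y)).comp (tendsto_id.const_mul_atTop' (r := 2) (by norm_num))) fun k => ?_)
      · rw [← map_add]
        refine map_mono_of_nonneg hf ?_
        have h0 : 0 ≤ k • u := nsmul_nonneg hu k
        rw [inf_comm, inf_comm x, inf_comm y]
        exact inf_add_le_of_nonneg h0 hx hy
      -- The doubled index is needed because `x ⊓ ku + y ⊓ ku` lies below `2ku`, not `ku`.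
      · rw [← map_add]
        refine map_mono_of_nonneg hf (le_inf (add_le_add inf_le_left inf_le_left) ?_)
        simp only [id]
        rw [two_mul, add_nsmul]
        exact add_le_add inf_le_right inf_le_right)
    (Eventually.of_forall fun k x hx => hf _ (le_inf hx (nsmul_nonneg hu k)))
    (Eventually.of_forall fun k x hx => map_mono_of_nonneg hf inf_le_left)
    (fun x _ => hlim x)
  exact ⟨g, fun x hx => by rw [hg x hx]; exact hlim x⟩

/-- A positive functional `f` splits off its restrictions to the bands generated by the terms of a
disjoint positive sequence. -/
lemma exists_disjoint_components {f : StrongDual ℝ E} (hf : IsPositiveOperator f) {x : ℕ → E}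
    (hx : ∀ n, 0 ≤ x n) (hdis : IsDisjointSeq x) :
    ∃ φ : ℕ → StrongDual ℝ E, (∀ n, IsPositiveOperator (φ n)) ∧
      (∀ N y, 0 ≤ y → ∑ n ∈ Finset.range N, φ n y ≤ f y) ∧
      (∀ n, φ n (x n) = f (x n)) ∧ ∀ m n, m ≠ n → φ m (x n) = 0 := by
  choose φ hφ using fun n => exists_band_restriction hf (hx n)
  refine ⟨φ, fun n y hy => ge_of_tendsto' (hφ n y hy) fun k =>
    hf _ (le_inf hy (nsmul_nonneg (hx n) k)), fun N y hy => ?_, fun n => ?_, fun m n hmn => ?_⟩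
  · refine le_of_tendsto' (tendsto_finsetSum _ fun n _ => hφ n y hy) fun k => ?_
    rw [← map_sum]
    -- For fixed `k` the truncations are disjoint and below `y`, so their sum is below `y`.
    have h0 : ∀ n, 0 ≤ y ⊓ k • x n := fun n => le_inf hy (nsmul_nonneg (hx n) k)
    refine map_mono_of_nonneg hf (sum_le_of_disjoint hy h0 (fun n => inf_le_left)
      fun i j hij => le_antisymm ?_ (le_inf (h0 i) (h0 j)))
    refine (inf_le_inf inf_le_right inf_le_right).trans
      (inf_nsmul_eq_zero (nsmul_nonneg (hx i) k) (hx j) ?_ k).le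
    rw [inf_comm]
    exact inf_nsmul_eq_zero (hx j) (hx i) (hdis.inf_eq_zero hx hij.symm) k
  · refine tendsto_nhds_unique (hφ n _ (hx n)) (tendsto_const_nhds.congr' ?_)
    filter_upwards [eventually_ge_atTop 1] with k hk
    rw [inf_eq_left.2]
    simpa using nsmul_le_nsmul_left (hx n) hk
  · refine tendsto_nhds_unique (hφ m _ (hx n)) (tendsto_const_nhds.congr fun k => ?_)
    rw [inf_nsmul_eq_zero (hx n) (hx m) (hdis.inf_eq_zero hx hmn.symm), map_zero]

end Bands

/-! ### Order continuity of the dual norm via disjoint sequences -/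

section DualOrderContinuous

variable {E : Type u} [NormedAddCommGroup E] [Lattice E] [HasSolidNorm E] [IsOrderedAddMonoid E]
  [NormedSpace ℝ E] [IsOrderedModule ℝ E]

/-- The sum of the band components of `f` converges pointwise on the positive cone to a functional
`G`; the remainders decrease to `0`, so their norms do too. The remainder starting at index `n`
still contains `φ n`, hence bounds `f (x n)`. -/
lemma DualHasOrderContinuousNorm.tendsto_of_disjoint (hE : DualHasOrderContinuousNorm E)
    {x : ℕ → E} (hx : ∀ n, 0 ≤ x n) (hdis : IsDisjointSeq x) {C : ℝ} (hC : ∀ n, ‖x n‖ ≤ C)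
    {f : StrongDual ℝ E} (hf : IsPositiveOperator f) :
    Tendsto (fun n => f (x n)) atTop (𝓝 0) := by
  obtain ⟨φ, hφ, hsum, hφx, -⟩ := exists_disjoint_components hf hx hdis
  have hS : ∀ y, 0 ≤ y → HasSum (fun n => φ n y) (∑' n, φ n y) := fun y hy =>
    (summable_of_sum_range_le (fun n => hφ n y hy) fun N => hsum N y hy).hasSum
  obtain ⟨G, hG⟩ := exists_strongDual_of_tendsto (l := atTop) (f := f)
    (q := fun N y => ∑ n ∈ Finset.range N, φ n y) (p := fun y => ∑' n, φ n y)
    (fun y z hy hz => by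
      rw [← (hS y hy).summable.tsum_add (hS z hz).summable]
      simp)
    (Eventually.of_forall fun k y hy => Finset.sum_nonneg fun n _ => hφ n y hy)
    (Eventually.of_forall fun k y hy => hsum k y hy)
    (fun y hy => (hS y hy).tendsto_sum_nat)
  let R : ULift.{u} ℕ → StrongDual ℝ E := fun N => G - ∑ n ∈ Finset.range N.down, φ n
  have hRx : ∀ N y, R N y = G y - ∑ n ∈ Finset.range N.down, φ n y := fun N y => by
    simp [R]
  have hdir : IsDirectedOrder (ULift.{u} ℕ) := ⟨fun a b => ⟨⟨max a.down b.down⟩,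
    le_max_left a.down b.down, le_max_right a.down b.down⟩⟩
  have hlim := hE (ULift.{u} ℕ) R (fun a b hab y hy => by
      rw [hRx, hRx]
      exact sub_le_sub_left (Finset.sum_le_sum_of_subset_of_nonneg (Finset.range_mono hab)
        fun i _ _ => hφ i y hy) _) (by
      constructor
      · rintro _ ⟨N, rfl⟩ y hy
        rw [hRx, hG y hy, zero_apply, sub_nonneg]
        exact sum_le_hasSum _ (fun i _ => hφ i y hy) (hS y hy)
      · intro h hh y hy
        have h1 : Tendsto (fun N => G y - ∑ n ∈ Finset.range N, φ n y) atTop (𝓝 0) := by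
          rw [hG y hy]
          simpa using (hS y hy).tendsto_sum_nat.const_sub (∑' n, φ n y)
        refine ge_of_tendsto' h1 fun N => ?_
        have := hh ⟨⟨N⟩, rfl⟩ y hy
        rwa [hRx] at this)
  have hup : Tendsto (fun N : ℕ => (ULift.up N : ULift.{u} ℕ)) atTop atTop :=
    tendsto_atTop.2 fun b => (eventually_ge_atTop b.down).mono fun N hN => hN
  have hlim2 : Tendsto (fun N : ℕ => ‖R ⟨N⟩‖ * C) atTop (𝓝 0) := by
    simpa using (hlim.comp hup).mul_const C
  refine squeeze_zero (fun n => hf _ (hx n)) (fun n => ?_) hlim2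
  have h1 : f (x n) ≤ R ⟨n⟩ (x n) := by
    rw [hRx, hG _ (hx n), le_sub_iff_add_le, ← hφx, add_comm, ← Finset.sum_range_succ]
    exact sum_le_hasSum _ (fun i _ => hφ i _ (hx n)) (hS _ (hx n))
  exact h1.trans ((le_abs_self _).trans (((R ⟨n⟩).le_opNorm _).trans
    (mul_le_mul_of_nonneg_left (hC n) (norm_nonneg _))))

/-- A net decreasing to `0` does so pointwise on the positive cone, since its pointwise infimum
there is a functional below the net. Disjointification for one member `g i₀` gives `w` such that,
for later `i`, `g i y ≤ g i w + g i₀ (y - w)⁺` is small uniformly on the positive part of the ball.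
-/
lemma dualHasOrderContinuousNorm_of_tendsto [CompleteSpace E]
    (h : ∀ (f : StrongDual ℝ E) (x : ℕ → E), IsPositiveOperator f → (∀ n, 0 ≤ x n) →
      IsDisjointSeq x → (∀ n, ‖x n‖ ≤ 1) → Tendsto (fun n => f (x n)) atTop (𝓝 0)) :
    DualHasOrderContinuousNorm E := by
  intro ι _ _ _ g hanti hglb
  have hg0 : ∀ i, IsPositiveOperator (g i) := fun i y hy => hglb.1 ⟨i, rfl⟩ y hy
  have hgm : ∀ y, 0 ≤ y → Antitone fun i => g i y := fun y hy i j hij => hanti hij y hy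
  have hlim : ∀ y, 0 ≤ y → Tendsto (fun i => g i y) atTop (𝓝 (⨅ i, g i y)) := fun y hy =>
    tendsto_atTop_ciInf (hgm y hy) ⟨0, by rintro _ ⟨i, rfl⟩; exact hg0 i y hy⟩
  obtain ⟨i₀⟩ := ‹Nonempty ι›
  obtain ⟨G, hG⟩ := exists_strongDual_of_tendsto (l := atTop) (f := g i₀) (q := fun i y => g i y)
    (p := fun y => ⨅ i, g i y)
    (fun y z hy hz => tendsto_nhds_unique (hlim _ (add_nonneg hy hz)) (by
      simpa using (hlim y hy).add (hlim z hz)))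
    (Eventually.of_forall hg0)
    ((eventually_ge_atTop i₀).mono fun i hi y hy => hgm y hy hi) hlim
  have hlim0 : ∀ y, 0 ≤ y → Tendsto (fun i => g i y) atTop (𝓝 0) := fun y hy => by
    have h1 := @hglb.2 G (by
      rintro _ ⟨i, rfl⟩ z hz
      rw [hG z hz]
      exact (hgm z hz).le_of_tendsto (hlim z hz) i) y hy
    have h2 : 0 ≤ G y := by
      rw [hG y hy]; exact ge_of_tendsto' (hlim y hy) fun i => hg0 i y hy
    have h3 := hlim y hy
    rwa [← hG y hy, le_antisymm h1 h2] at h3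
  rw [Metric.tendsto_nhds]
  intro ε hε
  obtain ⟨w, hw, hA⟩ := exists_norm_map_posPart_sub_le (T := g i₀) (hg0 i₀)
    (A := {y : E | 0 ≤ y ∧ ‖y‖ ≤ 1}) (C := 1) (fun y hy => hy.1) (fun y hy => hy.2)
    (fun v hv hdis hvA => by
      refine tendsto_zero_iff_norm_tendsto_zero.1 (h (g i₀) v (hg0 i₀) hv hdis fun n => ?_)
      obtain ⟨y, hy, hvy⟩ := hvA n
      exact (norm_le_norm_of_nonneg_of_le (hv n) hvy).trans hy.2) (ε := ε / 3) (by positivity)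
  obtain ⟨i₁, hi₁⟩ := ((hlim0 w hw).eventually_le_const (show 0 < ε / 3 by positivity)).exists
  obtain ⟨j, hj0, hj1⟩ := exists_ge_ge i₀ i₁
  filter_upwards [eventually_ge_atTop j] with i hi
  rw [Real.dist_0_eq_abs, abs_norm]
  refine lt_of_le_of_lt (norm_le_of_forall_nonneg (hg0 i) (C := 2 * (ε / 3)) (by positivity)
    fun y hy hy1 => ?_) (by linarith)
  have h1 : g i (y ⊓ w) ≤ ε / 3 := (map_mono_of_nonneg (hg0 i) inf_le_right).trans
    ((hgm w hw (hj1.trans hi)).trans hi₁)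
  have h2 : g i (y - w)⁺ ≤ ε / 3 := (hgm _ (posPart_nonneg _) (hj0.trans hi)).trans
    ((le_abs_self _).trans (hA y ⟨hy, hy1⟩))
  rw [← inf_add_posPart_sub y w, map_add]
  linarith

end DualOrderContinuous

/-! ### Order continuous dual norm implies semi-compactness -/

section SemiCompact

variable {E : Type u} [NormedAddCommGroup E] [Lattice E] [HasSolidNorm E] [IsOrderedAddMonoid E]
  [NormedSpace ℝ E] [IsOrderedModule ℝ E] [CompleteSpace E]

/-- Disjointification for the identity makes `(y n - u)⁺` uniformly small; what remains, `y n ⊓ u`,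
is order bounded and weakly null. -/
lemma IsLWeaklyCompact.tendsto_norm (hE : HasOrderContinuousNorm E) {y : ℕ → E}
    (hy : IsLWeaklyCompact (range y)) (hy0 : ∀ n, 0 ≤ y n)
    (hw : ∀ f : StrongDual ℝ E, IsPositiveOperator f → Tendsto (fun n => f (y n)) atTop (𝓝 0)) :
    Tendsto (fun n => ‖y n‖) atTop (𝓝 0) := by
  obtain ⟨hb, hd⟩ := hy
  obtain ⟨C, hC⟩ := hb.exists_norm_le
  rw [Metric.tendsto_nhds]
  intro ε hε
  obtain ⟨u, hu, hA⟩ := exists_norm_map_posPart_sub_le (T := ContinuousLinearMap.id ℝ E)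
    (fun _ h => h) (A := range y) (by rintro _ ⟨n, rfl⟩; exact hy0 n) hC
    (fun v hv hdis hvA => hd v hdis fun n => by
      obtain ⟨x, hx, hvx⟩ := hvA n
      exact ⟨x, hx, by rwa [abs_of_nonneg (hv n), abs_of_nonneg ((hv n).trans hvx)]⟩)
    (ε := ε / 2) (by positivity)
  have h0 : ∀ n, 0 ≤ y n ⊓ u := fun n => le_inf (hy0 n) hu
  have h1 := hE.tendsto_norm_of_orderBounded (z := fun n => y n ⊓ u) h0
    (fun n => inf_le_right) fun f hf => squeeze_zero (fun n => hf _ (h0 n))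
      (fun n => map_mono_of_nonneg hf inf_le_left) (hw f hf)
  filter_upwards [h1.eventually_lt_const (show 0 < ε / 2 by positivity)] with n hn
  rw [Real.dist_0_eq_abs, abs_norm]
  have h2 := hA (y n) ⟨n, rfl⟩
  rw [ContinuousLinearMap.id_apply] at h2
  calc ‖y n‖ = ‖y n ⊓ u + (y n - u)⁺‖ := by rw [inf_add_posPart_sub]
    _ ≤ ‖y n ⊓ u‖ + ‖(y n - u)⁺‖ := norm_add_le _ _
    _ < ε := by linarith

lemma isRelWeaklyCompact_range_of_tendsto {X : Type*} [NormedAddCommGroup X] [NormedSpace ℝ X]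
    {x : ℕ → X} (hx : ∀ f : StrongDual ℝ X, Tendsto (fun n => f (x n)) atTop (𝓝 0)) :
    IsRelWeaklyCompact (range x) := by
  have h1 : Tendsto (fun n => toWeakSpace ℝ X (x n)) atTop (𝓝 (toWeakSpace ℝ X 0)) := by
    refine (WeakBilin.tendsto_iff_forall_eval_tendsto (topDualPairing ℝ X).flip ?_).2 fun f => ?_
    · exact fun a b hab => (SeparatingDual.eq_iff_forall_dual_eq (R := ℝ)).2 fun g =>
        DFunLike.congr_fun hab g
    · have h2 := hx f
      rw [← map_zero f] at h2
      exact h2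
  refine h1.isCompact_insert_range.closure_of_subset ?_
  rintro _ ⟨_, ⟨n, rfl⟩, rfl⟩
  exact Or.inr ⟨n, rfl⟩

lemma IsAlmostLWeaklyCompact.isSemiCompact (hE : HasOrderContinuousNorm E)
    (hE' : DualHasOrderContinuousNorm E) {T : E →L[ℝ] E} (hT : IsPositiveOperator T)
    (hTL : IsAlmostLWeaklyCompact T) : IsSemiCompact T := by
  intro ε hε
  obtain ⟨u, hu, hA⟩ := exists_norm_map_posPart_sub_le hT (A := {y : E | 0 ≤ y ∧ ‖y‖ ≤ 1}) (C := 1)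
    (fun y hy => hy.1) (fun y hy => hy.2)
    (fun v hv hdis hvA => by
      have hw := fun f hf => hE'.tendsto_of_disjoint hv hdis (C := 1) (fun n => by
        obtain ⟨y, hy, hvy⟩ := hvA n
        exact (norm_le_norm_of_nonneg_of_le (hv n) hvy).trans hy.2) (f := f) hf
      have hL := hTL _ (isRelWeaklyCompact_range_of_tendsto (tendsto_zero_of_forall_nonneg hw))
      rw [← range_comp] at hL
      exact hL.tendsto_norm hE (fun n => hT _ (hv n)) fun f hf =>
        hw (f.comp T) fun x hx => hf _ (hT _ hx)) (ε := ε / 2) (by positivity)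
  refine ⟨T u, hT u hu, ?_⟩
  rintro _ ⟨x, hx, rfl⟩
  rw [mem_closedBall_zero_iff] at hx
  have hp := hA x⁺ ⟨posPart_nonneg x, (norm_posPart_le x).trans hx⟩
  have hn := hA x⁻ ⟨negPart_nonneg x, (norm_negPart_le x).trans hx⟩
  have hp0 : 0 ≤ T (x⁺ ⊓ u) := hT _ (le_inf (posPart_nonneg x) hu)
  have hn0 : 0 ≤ T (x⁻ ⊓ u) := hT _ (le_inf (negPart_nonneg x) hu)
  have hpu : T (x⁺ ⊓ u) ≤ T u := map_mono_of_nonneg hT inf_le_right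
  have hnu : T (x⁻ ⊓ u) ≤ T u := map_mono_of_nonneg hT inf_le_right
  rw [smul_unitClosedBall_of_nonneg hε.le]
  refine ⟨T (x⁺ ⊓ u) - T (x⁻ ⊓ u), ⟨?_, (sub_le_self _ hn0).trans hpu⟩,
    T (x⁺ - u)⁺ - T (x⁻ - u)⁺, ?_, ?_⟩
  · rw [neg_le_sub_iff_le_add]
    exact hnu.trans (le_add_of_nonneg_left hp0)
  · rw [mem_closedBall_zero_iff]
    refine (norm_sub_le _ _).trans ?_
    linarith
  · change T (x⁺ ⊓ u) - T (x⁻ ⊓ u) + (T (x⁺ - u)⁺ - T (x⁻ - u)⁺) = T x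
    rw [sub_add_sub_comm, ← map_add, ← map_add, inf_add_posPart_sub, inf_add_posPart_sub, ← map_sub,
      posPart_sub_negPart]

end SemiCompact

/-! ### The Schur property and tails on weakly compact sets -/

section Schur

/-- The Schur property of `ℓ¹`: weakly null sequences are norm null. -/
lemma tendsto_tsum_abs_of_forall_tendsto {z : ℕ → ℕ → ℝ} (hz : ∀ j, Summable fun n => |z j n|)
    (h : ∀ c : ℕ → ℝ, (∀ n, |c n| ≤ 1) → Tendsto (fun j => ∑' n, c n * z j n) atTop (𝓝 0)) :
    Tendsto (fun j => ∑' n, |z j n|) atTop (𝓝 0) := by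
  classical
  have hcoord : ∀ n, Tendsto (fun j => z j n) atTop (𝓝 0) := fun n => by
    refine (h (Pi.single n 1) fun m => ?_).congr fun j => ?_
    · by_cases hm : m = n
      · subst hm; simp
      · simp [hm]
    · rw [tsum_eq_single n fun m hm => by simp [hm]]
      simp
  have hle : ∀ (c : ℕ → Icc (-1 : ℝ) 1) j n, ‖(c n : ℝ) * z j n‖ ≤ |z j n| := fun c j n => by
    rw [norm_mul, Real.norm_eq_abs, Real.norm_eq_abs]
    exact mul_le_of_le_one_left (abs_nonneg _) (abs_le.2 (c n).2)
  rw [Metric.tendsto_nhds]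
  intro ε hε
  -- Baire category on the compact cube `[-1, 1]^ℕ`: some `B N` contains a basic open set, which
  -- constrains only the finitely many coordinates in `I`.
  let B : ℕ → Set (ℕ → Icc (-1 : ℝ) 1) := fun N =>
    ⋂ j ∈ Ici N, {c | |∑' n, (c n : ℝ) * z j n| ≤ ε / 2}
  have hBc : ∀ N, IsClosed (B N) := fun N => isClosed_biInter fun j _ => by
    refine isClosed_le (Continuous.abs ?_) continuous_const
    refine continuous_tsum (fun n => ?_) (hz j) fun n c => hle c j n
    fun_prop
  have hBu : ⋃ N, B N = univ := eq_univ_of_forall fun c => by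
    have h1 := (h (fun n => c n) fun n => abs_le.2 (c n).2).abs
    rw [abs_zero] at h1
    obtain ⟨N, hN⟩ := eventually_atTop.1 (h1.eventually_le_const (show 0 < ε / 2 by positivity))
    exact mem_iUnion.2 ⟨N, mem_iInter₂.2 fun j hj => hN j hj⟩
  have : Nonempty (ℕ → Icc (-1 : ℝ) 1) := ⟨fun _ => ⟨0, by norm_num⟩⟩
  obtain ⟨N, c₀, hc₀⟩ := nonempty_interior_of_iUnion_of_closed hBc hBu
  obtain ⟨I, u, hu, hIu⟩ := isOpen_pi_iff.1 isOpen_interior c₀ hc₀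
  have hfin : Tendsto (fun j => ∑ n ∈ I, 2 * |z j n|) atTop (𝓝 0) := by
    have := tendsto_finsetSum I fun n _ => ((hcoord n).abs.const_mul 2)
    simpa using this
  filter_upwards [hfin.eventually_lt_const (show 0 < ε / 2 by positivity),
    eventually_ge_atTop N] with j hj hNj
  rw [Real.dist_0_eq_abs, abs_of_nonneg (tsum_nonneg fun n => abs_nonneg _)]
  -- Off `I` the coordinates are free, so they may be the signs of `z j n`; then `|z j n| ≤ c n * z
  -- j n` there, and on `I` adding `2 * |z j n|` suffices.
  let c : ℕ → Icc (-1 : ℝ) 1 := fun n =>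
    if n ∈ I then c₀ n else if 0 ≤ z j n then ⟨1, by norm_num⟩ else ⟨-1, by norm_num⟩
  have hcB : c ∈ B N := interior_subset (hIu fun n hn => by
    have : n ∈ I := hn
    simpa [c, this] using (hu n hn).2)
  have hcz : |∑' n, (c n : ℝ) * z j n| ≤ ε / 2 := mem_iInter₂.1 hcB j hNj
  have hsum1 : Summable fun n => (c n : ℝ) * z j n :=
    Summable.of_norm_bounded (hz j) fun n => hle c j n
  have hsum2 : HasSum (fun n => if n ∈ I then 2 * |z j n| else 0) (∑ n ∈ I, 2 * |z j n|) := by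
    have := hasSum_sum_of_ne_finset_zero (L := SummationFilter.unconditional ℕ)
      (f := fun n => if n ∈ I then 2 * |z j n| else 0) (s := I)
      fun n hn => by simp [hn]
    rwa [Finset.sum_congr rfl fun n hn => if_pos hn] at this
  have hmain := hasSum_le (fun n => ?_) (hz j).hasSum (hsum1.hasSum.add hsum2)
  · have := le_abs_self (∑' n, (c n : ℝ) * z j n)
    linarith
  · by_cases hn : n ∈ I
    · have h1 := hle c j n
      rw [Real.norm_eq_abs] at h1
      have h2 := neg_abs_le ((c n : ℝ) * z j n)
      simp only [hn, if_true]
      linarith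
    · by_cases h0 : 0 ≤ z j n
      · simp [c, hn, h0, abs_of_nonneg h0]
      · simp [c, hn, h0, abs_of_neg (not_le.1 h0)]

lemma IsRelWeaklyCompact.exists_abs_le {X : Type*} [NormedAddCommGroup X] [NormedSpace ℝ X]
    {A : Set X} (hA : IsRelWeaklyCompact A) (f : StrongDual ℝ X) : ∃ M, ∀ x ∈ A, |f x| ≤ M := by
  have hc : Continuous fun x : WeakSpace ℝ X => (topDualPairing ℝ X).flip x f :=
    WeakBilin.eval_continuous _ f
  obtain ⟨M, hM⟩ := hA.bddAbove_image hc.abs.continuousOn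
  exact ⟨M, fun x hx => hM ⟨toWeakSpace ℝ X x, subset_closure ⟨x, hx, rfl⟩, rfl⟩⟩

/-- A sequence of functionals inducing an operator into `ℓ¹` has uniformly small tails on
relatively weakly compact sets. -/
lemma IsRelWeaklyCompact.exists_tail_le {X : Type*} [NormedAddCommGroup X] [NormedSpace ℝ X]
    {A : Set X} (hA : IsRelWeaklyCompact A) {φ : ℕ → StrongDual ℝ X}
    (hφ : ∀ x, Summable fun n => |φ n x|)
    (hc : ∀ c : ℕ → ℝ, (∀ n, |c n| ≤ 1) →
      ∃ g : StrongDual ℝ X, ∀ x, HasSum (fun n => φ n x • c n) (g x)) {ε : ℝ} (hε : 0 < ε) :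
    ∃ N, ∀ x ∈ A, ∑' n, |φ (n + N) x| ≤ ε := by
  by_contra! hcon
  choose x hxA hx using hcon
  have hcont : ∀ f : StrongDual ℝ X,
      Continuous fun x : WeakSpace ℝ X => f ((toWeakSpace ℝ X).symm x) :=
    fun f => WeakBilin.eval_continuous (topDualPairing ℝ X).flip f
  let Φ : WeakSpace ℝ X → ℕ → ℝ := fun x n => φ n ((toWeakSpace ℝ X).symm x)
  have hΦ : Continuous Φ := continuous_pi fun n => hcont (φ n)
  let a : ℕ → WeakSpace ℝ X := fun N => toWeakSpace ℝ X (x N)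
  have ha : ∀ N, a N ∈ closure (toWeakSpace ℝ X '' A) := fun N =>
    subset_closure ⟨x N, hxA N, rfl⟩
  -- Passing to the metrizable space `ℝ^ℕ` of coordinates gives a convergent subsequence without the
  -- Eberlein–Šmulian theorem.
  obtain ⟨_, ⟨y, hy, rfl⟩, ψ, hψ, hlim⟩ :=
    (IsCompact.image hA hΦ).tendsto_subseq fun N => mem_image_of_mem Φ (ha N)
  set y' : X := (toWeakSpace ℝ X).symm y with hy'
  have hg : ∀ (c : ℕ → ℝ) (g : StrongDual ℝ X), (∀ x, HasSum (fun n => φ n x • c n) (g x)) →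
      Tendsto (fun k => g (x (ψ k))) atTop (𝓝 (g y')) := fun c g hgc => by
    -- A weak ultrafilter limit `w` may differ from `y`, but it has the same coordinates, and these
    -- determine `g`.
    rw [tendsto_iff_ultrafilter]
    intro U hU
    obtain ⟨w, -, hw⟩ := hA.ultrafilter_le_nhds' (U.map (a ∘ ψ))
      (Ultrafilter.mem_map.2 (univ_mem' fun k => ha (ψ k)))
    have hw' : Tendsto (a ∘ ψ) U (𝓝 w) := hw
    have h1 : Φ w = Φ y := tendsto_nhds_unique ((hΦ.tendsto w).comp hw') (hlim.mono_left hU)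
    have h2 : g ((toWeakSpace ℝ X).symm w) = g y' := by
      refine (hgc _).unique ?_
      convert hgc y' using 3 with n
      exact congrFun h1 n
    rw [← h2]
    exact ((hcont g).tendsto w).comp hw'
  let z : ℕ → ℕ → ℝ := fun j n => φ n (x (ψ j)) - φ n y'
  have hz : ∀ j, Summable fun n => |z j n| := fun j => by
    simpa [z] using hφ (x (ψ j) - y')
  have hz0 := tendsto_tsum_abs_of_forall_tendsto hz fun c hc1 => by
    obtain ⟨g, hgc⟩ := hc c hc1
    have h1 := (hg c g hgc).sub_const (g y')
    rw [sub_self] at h1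
    refine h1.congr fun j => ?_
    rw [← map_sub, ← (hgc _).tsum_eq]
    refine tsum_congr fun n => ?_
    simp only [z, map_sub, smul_eq_mul, mul_comm]
  have htail := (tendsto_sum_nat_add fun n => |φ n y'|).comp hψ.tendsto_atTop
  have hsum := hz0.add htail
  rw [add_zero] at hsum
  refine hε.not_ge (ge_of_tendsto' hsum fun j => (hx (ψ j)).le.trans ?_)
  have s1 := (summable_nat_add_iff (ψ j)).2 (hz j)
  have s2 := (summable_nat_add_iff (ψ j)).2 (hφ y')
  have h1 : ∑' n, |z j (n + ψ j)| ≤ ∑' n, |z j n| := by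
    rw [← (hz j).sum_add_tsum_nat_add (ψ j)]
    exact le_add_of_nonneg_left (Finset.sum_nonneg fun n _ => abs_nonneg _)
  calc ∑' n, |φ (n + ψ j) (x (ψ j))| ≤ ∑' n, (|z j (n + ψ j)| + |φ (n + ψ j) y'|) := by
        refine ((summable_nat_add_iff (ψ j)).2 (hφ (x (ψ j)))).tsum_le_tsum (fun n => ?_) (s1.add s2)
        calc |φ (n + ψ j) (x (ψ j))| = |z j (n + ψ j) + φ (n + ψ j) y'| := by simp [z]
          _ ≤ _ := abs_add_le _ _
    _ = ∑' n, |z j (n + ψ j)| + ∑' n, |φ (n + ψ j) y'| := s1.tsum_add s2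
    _ ≤ _ := add_le_add_left h1 _

end Schur

/-! ### Semi-compactness implies order continuous dual norm -/

section Converse

variable {E : Type u} [NormedAddCommGroup E] [Lattice E] [HasSolidNorm E] [IsOrderedAddMonoid E]
  [NormedSpace ℝ E] [IsOrderedModule ℝ E]

/-- For a disjoint sequence in the solid hull, the truncations `|d n| ⊓ u` are disjoint and order
bounded, hence norm null, while the excess is at most that of an element of `A`. -/
lemma isLWeaklyCompact_of_almost_orderBounded (hE : HasOrderContinuousNorm E) {A : Set E}
    (hA : ∀ ε : ℝ, 0 < ε → ∃ u, 0 ≤ u ∧ ∀ y ∈ A, ‖(|y| - u)⁺‖ ≤ ε) : IsLWeaklyCompact A := by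
  have hsplit : ∀ y u : E, 0 ≤ u → ‖y‖ ≤ ‖|y| ⊓ u‖ + ‖(|y| - u)⁺‖ := fun y u hu => by
    conv_lhs => rw [← norm_abs_eq_norm, ← inf_add_posPart_sub |y| u]
    exact norm_add_le _ _
  constructor
  · obtain ⟨u, hu, huA⟩ := hA 1 one_pos
    refine isBounded_iff_forall_norm_le.2 ⟨‖u‖ + 1, fun y hy => (hsplit y u hu).trans ?_⟩
    exact add_le_add (norm_le_norm_of_nonneg_of_le (le_inf (abs_nonneg y) hu) inf_le_right)
      (huA y hy)
  · intro d hd hdA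
    rw [Metric.tendsto_nhds]
    intro ε hε
    obtain ⟨u, hu, huA⟩ := hA (ε / 2) (by positivity)
    have h0 : ∀ n, 0 ≤ |d n| ⊓ u := fun n => le_inf (abs_nonneg _) hu
    have h1 := hE.tendsto_norm_of_disjoint h0 (hd.abs_inf_mono fun n => by
      rw [abs_of_nonneg (h0 n)]; exact inf_le_left) fun n => inf_le_right
    filter_upwards [h1.eventually_lt_const (show 0 < ε / 2 by positivity)] with n hn
    rw [Real.dist_0_eq_abs, abs_norm]
    obtain ⟨y, hy, hdy⟩ := hdA n
    have h2 := (norm_le_norm_of_nonneg_of_le (posPart_nonneg (|d n| - u))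
      (posPart_mono (sub_le_sub_right hdy u))).trans (huA y hy)
    linarith [hsplit (d n) u hu]

lemma summable_abs_of_sum_le {φ : ℕ → StrongDual ℝ E} {f : StrongDual ℝ E}
    (hφ : ∀ n, IsPositiveOperator (φ n))
    (hsum : ∀ N y, 0 ≤ y → ∑ n ∈ Finset.range N, φ n y ≤ f y) (x : E) :
    Summable (fun n => |φ n x|) ∧ ∑' n, |φ n x| ≤ ‖f‖ * ‖x‖ := by
  have h : ∀ N, ∑ n ∈ Finset.range N, |φ n x| ≤ ‖f‖ * ‖x‖ := fun N =>
    (Finset.sum_le_sum fun n _ => abs_map_le (hφ n) x).trans ((hsum N _ (abs_nonneg x)).trans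
      ((le_abs_self _).trans ((f.le_opNorm _).trans (by rw [norm_abs_eq_norm]))))
  exact ⟨summable_of_sum_range_le (fun n => abs_nonneg _) h,
    Real.tsum_le_of_sum_range_le (fun n => abs_nonneg _) h⟩

/-- The operator `x ↦ ∑ φ n x • y n`, which factors through `ℓ¹`. -/
lemma exists_hasSum_smul {φ : ℕ → StrongDual ℝ E} {f : StrongDual ℝ E}
    (hφ : ∀ n, IsPositiveOperator (φ n))
    (hsum : ∀ N y, 0 ≤ y → ∑ n ∈ Finset.range N, φ n y ≤ f y)
    {F : Type*} [NormedAddCommGroup F] [NormedSpace ℝ F] [CompleteSpace F] {y : ℕ → F}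
    (hy : ∀ n, ‖y n‖ ≤ 1) : ∃ T : E →L[ℝ] F, ∀ x, HasSum (fun n => φ n x • y n) (T x) := by
  have hb : ∀ x n, ‖φ n x • y n‖ ≤ |φ n x| := fun x n => by
    rw [norm_smul, Real.norm_eq_abs]
    exact mul_le_of_le_one_right (abs_nonneg _) (hy n)
  have hs : ∀ x, Summable fun n => φ n x • y n := fun x =>
    Summable.of_norm_bounded (summable_abs_of_sum_le hφ hsum x).1 (hb x)
  let L : E →ₗ[ℝ] F :=
    { toFun := fun x => ∑' n, φ n x • y n
      map_add' := fun a b => by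
        rw [← (hs a).tsum_add (hs b)]
        simp only [map_add, add_smul]
      map_smul' := fun r a => by
        rw [RingHom.id_apply, ← (hs a).tsum_const_smul]
        simp only [map_smul, smul_assoc] }
  refine ⟨L.mkContinuous ‖f‖ fun x => ?_, fun x => (hs x).hasSum⟩
  exact (tsum_of_norm_bounded (summable_abs_of_sum_le hφ hsum x).1.hasSum (hb x)).trans
    (summable_abs_of_sum_le hφ hsum x).2

/-- On `A` the finite head of the series is order bounded and, by the Schur tail estimate, the rest
has norm at most `ε`. -/
lemma isAlmostLWeaklyCompact_of_hasSum (hE : HasOrderContinuousNorm E)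
    {φ : ℕ → StrongDual ℝ E} {f : StrongDual ℝ E} (hφ : ∀ n, IsPositiveOperator (φ n))
    (hsum : ∀ N y, 0 ≤ y → ∑ n ∈ Finset.range N, φ n y ≤ f y)
    {y : ℕ → E} (hy0 : ∀ n, 0 ≤ y n) (hy : ∀ n, ‖y n‖ ≤ 1) {T : E →L[ℝ] E}
    (hT : ∀ x, HasSum (fun n => φ n x • y n) (T x)) : IsAlmostLWeaklyCompact T := by
  intro A hA
  have hs := fun x => (summable_abs_of_sum_le hφ hsum x).1
  choose M hM using fun n => hA.exists_abs_le (φ n)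
  refine isLWeaklyCompact_of_almost_orderBounded hE fun ε hε => ?_
  obtain ⟨N, hN⟩ := hA.exists_tail_le hs
    (fun c hc => exists_hasSum_smul hφ hsum fun n => by simpa using hc n) hε
  refine ⟨∑ n ∈ Finset.range N, |M n| • y n,
    Finset.sum_nonneg fun n _ => smul_nonneg (abs_nonneg _) (hy0 n), ?_⟩
  rintro _ ⟨x, hx, rfl⟩
  have habs : ∀ n, |φ n x • y n| ≤ |M n| • y n := fun n => by
    have h1 : |φ n x| ≤ |M n| := (hM n x hx).trans (le_abs_self _)
    refine abs_le'.2 ⟨smul_le_smul_of_nonneg_right ((le_abs_self _).trans h1) (hy0 n), ?_⟩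
    rw [← neg_smul]
    exact smul_le_smul_of_nonneg_right ((neg_le_abs _).trans h1) (hy0 n)
  set p := ∑ n ∈ Finset.range N, φ n x • y n with hp
  have hpu : |p| ≤ ∑ n ∈ Finset.range N, |M n| • y n := by
    refine abs_le'.2 ⟨Finset.sum_le_sum fun n _ => (le_abs_self _).trans (habs n), ?_⟩
    rw [hp, ← Finset.sum_neg_distrib]
    exact Finset.sum_le_sum fun n _ => (neg_le_abs _).trans (habs n)
  have hq : HasSum (fun n => φ (n + N) x • y (n + N)) (T x - p) :=
    (hasSum_nat_add_iff' N).2 (hT x)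
  have hqn : ‖T x - p‖ ≤ ε := by
    rw [← hq.tsum_eq]
    refine (tsum_of_norm_bounded ((summable_nat_add_iff N).2 (hs x)).hasSum fun n => ?_).trans
      (hN x hx)
    rw [norm_smul, Real.norm_eq_abs]
    exact mul_le_of_le_one_right (abs_nonneg _) (hy _)
  refine le_trans ?_ hqn
  rw [← norm_abs_eq_norm (T x - p)]
  refine norm_le_norm_of_nonneg_of_le (posPart_nonneg _) (sup_le ?_ (abs_nonneg _))
  rw [sub_le_iff_le_add]
  calc |T x| = |(T x - p) + p| := by rw [sub_add_cancel]
    _ ≤ |T x - p| + |p| := abs_add_le _ _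
    _ ≤ _ := add_le_add_right hpu _

lemma dualHasOrderContinuousNorm_of_isSemiCompact [CompleteSpace E] (hE : HasOrderContinuousNorm E)
    (h : ∀ T : E →L[ℝ] E, IsPositiveOperator T → IsAlmostLWeaklyCompact T → IsSemiCompact T) :
    DualHasOrderContinuousNorm E := by
  refine dualHasOrderContinuousNorm_of_tendsto fun f x hf hx hdis hx1 => ?_
  obtain ⟨φ, hφ, hsum, hφx, hφ0⟩ := exists_disjoint_components hf hx hdis
  obtain ⟨T, hT⟩ := exists_hasSum_smul hφ hsum hx1
  have hTx : ∀ n, T (x n) = f (x n) • x n := fun n => by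
    rw [← hφx n]
    exact (hT (x n)).unique (hasSum_single n fun m hm => by rw [hφ0 m n hm, zero_smul])
  have hsemi := h T (fun y hy => (hT y).nonneg fun n => smul_nonneg (hφ n y hy) (hx n))
    (isAlmostLWeaklyCompact_of_hasSum hE hφ hsum hx hx1 hT)
  have hT0 : ∀ n, 0 ≤ T (x n) := fun n => by
    rw [hTx]; exact smul_nonneg (hf _ (hx n)) (hx n)
  have hL : IsLWeaklyCompact (range fun n => T (x n)) :=
    isLWeaklyCompact_of_almost_orderBounded hE fun ε hε => by
      obtain ⟨v, hv, hTv⟩ := hsemi ε hε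
      refine ⟨v, hv, ?_⟩
      rintro _ ⟨n, rfl⟩
      obtain ⟨a, ha, b, hb, hab⟩ := hTv ⟨x n, mem_closedBall_zero_iff.2 (hx1 n), rfl⟩
      rw [smul_unitClosedBall_of_nonneg hε.le, mem_closedBall_zero_iff] at hb
      refine le_trans ?_ hb
      rw [← norm_abs_eq_norm b, abs_of_nonneg (hT0 n)]
      refine norm_le_norm_of_nonneg_of_le (posPart_nonneg _) (sup_le ?_ (abs_nonneg _))
      rw [sub_le_iff_le_add', ← hab]
      exact add_le_add ha.2 (le_abs_self b)
  have hdisT : IsDisjointSeq fun n => T (x n) := fun m n hmn => by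
    rw [abs_of_nonneg (hT0 m), abs_of_nonneg (hT0 n), hTx, hTx, inf_comm]
    refine inf_smul_eq_zero (smul_nonneg (hf _ (hx n)) (hx n)) (hx m) ?_ (hf _ (hx m))
    rw [inf_comm]
    exact inf_smul_eq_zero (hx m) (hx n) (hdis.inf_eq_zero hx hmn) (hf _ (hx n))
  have hlim := hL.2 _ hdisT fun n => ⟨T (x n), ⟨n, rfl⟩, le_rfl⟩
  -- The `x n` need not be bounded below in norm; `f (x n) ≤ ‖f‖ * ‖x n‖` gives `f (x n) ^ 2 ≤ ‖f‖ *
  -- ‖T (x n)‖`.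
  have hsq : Tendsto (fun n => f (x n) ^ 2) atTop (𝓝 0) := by
    have h1 : Tendsto (fun n => ‖f‖ * ‖T (x n)‖) atTop (𝓝 0) := by simpa using hlim.const_mul ‖f‖
    refine squeeze_zero (fun n => sq_nonneg _) (fun n => ?_) h1
    rw [hTx, norm_smul, Real.norm_of_nonneg (hf _ (hx n)), sq, mul_left_comm]
    exact mul_le_mul_of_nonneg_left ((le_abs_self _).trans (f.le_opNorm _)) (hf _ (hx n))
  have h2 := (Real.continuous_sqrt.tendsto 0).comp hsq
  rw [Real.sqrt_zero] at h2
  exact h2.congr fun n => Real.sqrt_sq (hf _ (hx n))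

end Converse

theorem theorem3 (E : Type u) [NormedAddCommGroup E] [Lattice E] [HasSolidNorm E]
    [IsOrderedAddMonoid E] [NormedSpace ℝ E] [IsOrderedModule ℝ E] [CompleteSpace E]
    (hE : HasOrderContinuousNorm E) :
    (∀ T : E →L[ℝ] E, IsPositiveOperator T → IsAlmostLWeaklyCompact T → IsSemiCompact T) ↔
      DualHasOrderContinuousNorm E :=
  ⟨dualHasOrderContinuousNorm_of_isSemiCompact hE, fun hE' _ hT hTL => hTL.isSemiCompact hE hE' hT⟩
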